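/- **Angle coherence under line contingency.** Consider a finite undirected weighted network whose nodes are split into a nonempty set $\mathcal N_g$ of synchronous machines (active nodes) and a set $\mathcal N_c$ of passive nodes, with line susceptances $b_{ij}=b_{ji}\ge 0$, $b_{ii}=0$ (there is a line $i$–$j$ iff $b_{ij}>0$), and Laplacian $$\boldsymbol L^{\rm ph}=\sum_{i<j}b_{ij}\,\boldsymbol e_{(i,j)}\boldsymbol e_{(i,j)}^\top=\begin{pmatrix}\boldsymbol L^{gg}&\boldsymbol L^{gc}\\ \boldsymbol L^{cg}&\boldsymbol L^{cc}\end{pmatrix},\qquad \boldsymbol e_{(i,j)}=\boldsymbol e_i-\boldsymbol e_j .$$ Let $\boldsymbol P=\boldsymbol L^{\rm ph}\boldsymbol\theta^\star$ be power injections with operating point $\boldsymbol\theta^\star=(\boldsymbol\theta^\star_g,\boldsymbol\theta^\star_c)$. Put $\boldsymbol L_{\rm red}=\boldsymbol L^{gg}-\boldsymbol L^{gc}[\boldsymbol L^{cc}]^{-1}\boldsymbol L^{cg}$ and $\boldsymbol P_{\rm red}=\boldsymbol P_g-\boldsymbol L^{gc}[\boldsymbol L^{cc}]^{-1}\boldsymbol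 P_c$. Let $\alpha$–$\beta$ be a line whose removal does not disconnect the network, and let $\boldsymbol L_{\rm red}'$, $\boldsymbol P_{\rm red}'$ be the same quantities formed with $\boldsymbol L^{\rm ph}-b_{\alpha\beta}\boldsymbol e_{(\alpha,\beta)}\boldsymbol e_{(\alpha,\beta)}^\top$ in place of $\boldsymbol L^{\rm ph}$ and the same $\boldsymbol P$. Let $d,\gamma>0$, $m=d/\gamma$ and $\tau\in\mathbb R$. For $\epsilon>0$ let $\boldsymbol\varphi_g=\boldsymbol\varphi_{g,\epsilon}$ be the deviation of the machine angles from $\boldsymbol\theta_g^\star$ in the regularized Kron-reduced swing dynamics under the Dirac-$\delta$ fault of the line at $t=0$, $$m\ddot{\boldsymbol\varphi}_g=-d\,\dot{\boldsymbol\varphi}_g-(\boldsymbol L_{\rm red}+\epsilon\mathbb I)\boldsymbol\varphi_g+\tau\,\delta(t)\big[(\boldsymbol P_{\rm red}'-\boldsymbol P_{\rm red})-(\boldsymbol L_{\rm red}'-\boldsymbol L_{\rm red})(\boldsymbol\theta_g^\star+\boldsymbol\varphi_g)\big],$$ with $\boldsymbol\varphi_g$ continuous and the system at rest, $(\boldsymbol\varphi_g,\dot{\boldsymbol\varphi}_g)=(0,0)$,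 before the fault. Then $\boldsymbol L^{cc}$ and its counterpart without the line are invertible, the denominators below are nonzero, and for every $\epsilon>0$ the response $\boldsymbol\varphi_{g,\epsilon}$ exists, is unique, and $\boldsymbol\varphi_{g,\epsilon}^\top\boldsymbol\varphi_{g,\epsilon}$ is integrable on $(0,\infty)$. The angle coherence measure $\mathcal P_{\boldsymbol\varphi}=\lim_{\epsilon\to0^+}\int_0^\infty\boldsymbol\varphi_{g,\epsilon}^\top\boldsymbol\varphi_{g,\epsilon}\,dt$ exists and equals $$\mathcal P_{\boldsymbol\varphi}=\frac{P_{\alpha,\beta}^2\tau^2}{2d}\,\Omega_{\alpha\beta}$$ if the faulted line connects two synchronous machines; $$\mathcal P_{\boldsymbol\varphi}=\frac{P_{\alpha,\beta}^2\tau^2}{2d}\;\frac{\Omega_{\alpha\beta}-\boldsymbol e_{(\alpha,\beta)}^\top[\boldsymbol L^{cc}]^{-1}\boldsymbol e_{(\alpha,\beta)}}{\big[1-b_{\alpha\beta}\,\boldsymbol e_{(\alpha,\beta)}^\top[\boldsymbol L^{cc}]^{-1}\boldsymbol e_{(\alpha,\beta)}\big]^2}$$ if it connects two passive nodes (here $\boldsymbol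 e_{(\alpha,\beta)}\in\mathbb R^{|\mathcal N_c|}$); and $$\mathcal P_{\boldsymbol\varphi}=\frac{P_{\alpha,\beta}^2\tau^2}{2d}\;\frac{\Omega_{\alpha\beta}-[\boldsymbol L^{cc}]^{-1}_{\beta\beta}}{\big[1-b_{\alpha\beta}[\boldsymbol L^{cc}]^{-1}_{\beta\beta}\big]^2}$$ if it connects a synchronous machine $\alpha$ and a passive node $\beta$. Here $P_{\alpha,\beta}=b_{\alpha\beta}(\theta^\star_\alpha-\theta^\star_\beta)$ is the power flow on the line prior to the fault and $\Omega_{\alpha\beta}=\boldsymbol e_{(\alpha,\beta)}^\top(\boldsymbol L^{\rm ph})^\dagger\boldsymbol e_{(\alpha,\beta)}$ is the resistance distance in the physical network prior to Kron reduction, $\dagger$ denoting the Moore–Penrose pseudoinverse. -/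

import Mathlib

open MeasureTheory Filter Topology Matrix

noncomputable section

namespace KronSwing

/-- An undirected weighted network on the buses `V`: `b i j > 0` is the susceptance of the line
between `i` and `j`, and `b i j = 0` means that there is no such line. -/
structure PowerNetwork (V : Type*) where
  /-- line susceptances -/
  b : V → V → ℝ
  symm : ∀ i j, b i j = b j i
  nonneg : ∀ i j, 0 ≤ b i j
  diag_zero : ∀ i, b i i = 0

/-- The vector `e_(i,j) = e_i - e_j`. -/
def edgeVec {V : Type*} [DecidableEq V] (i j : V) : V → ℝ :=
  Pi.single i 1 - Pi.single j 1

/-- The Moore-Penrose pseudoinverse `T diag(λ⁻¹) Tᵀ` of a real symmetric matrix `T diag(λ) Tᵀ`,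
where zero eigenvalues are kept equal to zero (in Lean `(0 : ℝ)⁻¹ = 0`). -/
def symPinv {V : Type*} [Fintype V] [DecidableEq V] {A : Matrix V V ℝ} (hA : A.IsHermitian) :
    Matrix V V ℝ :=
  (hA.eigenvectorUnitary : Matrix V V ℝ) * Matrix.diagonal (fun i => (hA.eigenvalues i)⁻¹) *
    (hA.eigenvectorUnitary : Matrix V V ℝ)ᵀ

namespace PowerNetwork

section General

variable {V : Type*} (N : PowerNetwork V)

/-- The graph of the lines of the network. -/
def graph : SimpleGraph V where
  Adj i j := 0 < N.b i j
  symm := ⟨fun i j h => by rw [N.symm j i]; exact h⟩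
  loopless := ⟨fun i h => by rw [N.diag_zero i] at h; exact lt_irrefl _ h⟩

variable [Fintype V] [DecidableEq V]

/-- The Laplacian matrix of the network. -/
def laplacian : Matrix V V ℝ :=
  Matrix.diagonal (fun i => ∑ j, N.b i j) - Matrix.of N.b

theorem laplacian_isHermitian : N.laplacian.IsHermitian := by
  refine Matrix.IsHermitian.ext fun i j => ?_
  by_cases h : i = j
  · subst h
    simp
  · simp [laplacian, Matrix.diagonal_apply_ne _ h, Matrix.diagonal_apply_ne' _ h, N.symm i j]

/-- The resistance distance `Ω_ij = e_(i,j)ᵀ L† e_(i,j)`. -/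
def resistanceDistance (i j : V) : ℝ :=
  edgeVec i j ⬝ᵥ (symPinv N.laplacian_isHermitian *ᵥ edgeVec i j)

/-- The Laplacian of the network without the line between `i` and `j`,
`L - b_ij e_(i,j) e_(i,j)ᵀ`. -/
def faultedLaplacian (i j : V) : Matrix V V ℝ :=
  N.laplacian - N.b i j • Matrix.vecMulVec (edgeVec i j) (edgeVec i j)

/-- `i` and `j` are joined by a line, and its removal does not split the network. -/
def IsNonsplittingLine (i j : V) : Prop :=
  N.graph.Adj i j ∧ (N.graph.deleteEdges {s(i, j)}).Connected

/-- The power flowing from `i` to `j` when the voltage angles are `θ`. -/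
def lineFlow (θ : V → ℝ) (i j : V) : ℝ := N.b i j * (θ i - θ j)

end General

end PowerNetwork

section Kron

variable {G C : Type*} [Fintype G] [Fintype C] [DecidableEq G] [DecidableEq C]

/-- Kron-reduced matrix `A^gg - A^gc (A^cc)⁻¹ A^cg`: the passive buses `C` are eliminated. -/
def kronMatrix (A : Matrix (G ⊕ C) (G ⊕ C) ℝ) : Matrix G G ℝ :=
  A.toBlocks₁₁ - A.toBlocks₁₂ * A.toBlocks₂₂⁻¹ * A.toBlocks₂₁

/-- Kron-reduced injections `P_g - A^gc (A^cc)⁻¹ P_c`. -/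
def kronInjection (A : Matrix (G ⊕ C) (G ⊕ C) ℝ) (P : G ⊕ C → ℝ) : G → ℝ :=
  (fun i => P (Sum.inl i)) - (A.toBlocks₁₂ * A.toBlocks₂₂⁻¹) *ᵥ (fun k => P (Sum.inr k))

/-- `φ` and `ω` are the angle and frequency deviations, relative to the operating point `θ`, of
the Kron-reduced swing dynamics with regularized Laplacian `L_red + ε I`, inertias `m` and
dampings `d`, after a Dirac-δ fault of strength `τ` of the line between `i` and `j`.
During the fault the Kron-reduced data `P_red`, `L_red` of the network are replaced by those
of the network without the line, i.e. `P_red(t) = P_red + τ δ(t) (P_red' - P_red)` and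
`L_red(t) = L_red + τ δ(t) (L_red' - L_red)`, so that
`M φ'' = -D φ' - (L_red + ε I) φ + τ δ(t) ((P_red' - P_red) - (L_red' - L_red) (θ_g + φ))`.
The system is at rest before the fault, and the equation is written in integrated form,
with `δ` the Dirac measure at time `0`. -/
structure IsFaultResponse (N : PowerNetwork (G ⊕ C)) (P θ : G ⊕ C → ℝ) (m d : G → ℝ) (τ : ℝ)
    (i j : G ⊕ C) (ε : ℝ) (φ ω : ℝ → G → ℝ) : Prop where
  angle_before : ∀ t < 0, φ t = 0
  freq_before : ∀ t < 0, ω t = 0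
  locallyIntegrable : LocallyIntegrable ω
  angle_eq : ∀ t, 0 ≤ t → φ t = ∫ s in (0 : ℝ)..t, ω s
  freq_eq : ∀ t, 0 ≤ t →
    Matrix.diagonal m *ᵥ ω t =
      (∫ s in (0 : ℝ)..t,
        (-(Matrix.diagonal d *ᵥ ω s)
          - (kronMatrix N.laplacian + ε • (1 : Matrix G G ℝ)) *ᵥ φ s)) +
      ∫ s in Set.Icc (0 : ℝ) t,
        τ • ((kronInjection (N.faultedLaplacian i j) P - kronInjection N.laplacian P)
          - (kronMatrix (N.faultedLaplacian i j) - kronMatrix N.laplacian) *ᵥ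
              ((fun k => θ (Sum.inl k)) + φ s)) ∂(Measure.dirac (0 : ℝ))

/-- The angle coherence measure `∫₀^∞ φᵀ φ dt`. -/
def angleCoherence (φ : ℝ → G → ℝ) : ℝ := ∫ t in Set.Ioi (0 : ℝ), φ t ⬝ᵥ φ t

/-- The angle coherence measure of the fault of the line between `i` and `j` has the regularized
value `v`: for every `ε > 0` the response to the fault exists, is unique, and has an integrable
`φᵀ φ`, and the angle coherence of the response tends to `v` as `ε → 0`, `ε > 0`. -/
def HasAngleCoherence (N : PowerNetwork (G ⊕ C)) (P θ : G ⊕ C → ℝ) (m d : G → ℝ) (τ : ℝ)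
    (i j : G ⊕ C) (v : ℝ) : Prop :=
  (∀ ε : ℝ, 0 < ε → ∃! x : (ℝ → G → ℝ) × (ℝ → G → ℝ),
    IsFaultResponse N P θ m d τ i j ε x.1 x.2) ∧
  ∀ φ ω : ℝ → ℝ → G → ℝ,
    (∀ ε : ℝ, 0 < ε → IsFaultResponse N P θ m d τ i j ε (φ ε) (ω ε)) →
      (∀ ε : ℝ, 0 < ε → IntegrableOn (fun t => φ ε t ⬝ᵥ φ ε t) (Set.Ioi 0)) ∧
      Tendsto (fun ε => angleCoherence (φ ε)) (𝓝[>] 0) (𝓝 v)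

/-- The passive blocks `L^cc` before and during the fault are invertible, that is, the Kron
reductions before and during the fault exist. -/
def KronReducible (N : PowerNetwork (G ⊕ C)) (i j : G ⊕ C) : Prop :=
  IsUnit N.laplacian.toBlocks₂₂.det ∧ IsUnit (N.faultedLaplacian i j).toBlocks₂₂.det

end Kron

end KronSwing

end


/-
Along `m φ'' = -d φ' - K φ` the vector `p = d φ + m φ'` satisfies `p' = -K φ`, so the storage
`(pᵀ K⁻¹ p + m φᵀ φ) / (2 d)` decreases at the rate `φᵀ φ`; as the trajectory decays, its angle
coherence is the initial storage, which is `Jᵀ K⁻¹ J / (2 d)` for the response to an impulse `J`.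
Here `K = L_red + ε I`. By the Sherman-Morrison formula for the passive block, the fault impulse
is `J = τ P_αβ / (1 - b_αβ r) • L_red y` with `y` the machine part of `L† e_(α,β)` and
`r = eᵀ (L^cc)⁻¹ e` on the passive part `e` of `e_(α,β)`. Since `J` lies in the range of `L_red`,
letting `ε → 0` turns `Jᵀ K⁻¹ J` into a multiple of `yᵀ L_red y`, and completing the square in the
passive angles gives `yᵀ L_red y = Ω_αβ - r`.
-/
noncomputable section

namespace KronSwing

section LinearAlgebra

variable {V : Type*} [Fintype V]

theorem edgeVec_dotProduct [DecidableEq V] (i j : V) (x : V → ℝ) :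
    edgeVec i j ⬝ᵥ x = x i - x j := by
  simp [edgeVec, sub_dotProduct]

theorem dotProduct_self_nonneg (x : V → ℝ) : 0 ≤ x ⬝ᵥ x := by
  simpa using dotProduct_star_self_nonneg x

theorem dotProduct_mulVec_comm {A : Matrix V V ℝ} (hA : A.IsHermitian) (x y : V → ℝ) :
    x ⬝ᵥ A *ᵥ y = y ⬝ᵥ A *ᵥ x := by
  have hAt : Aᵀ = A := by rw [← conjTranspose_eq_transpose_of_trivial, hA]
  rw [dotProduct_mulVec, ← mulVec_transpose, hAt, dotProduct_comm]

variable [DecidableEq V] {A : Matrix V V ℝ}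

theorem inv_mulVec_eq_of_mulVec_eq (hA : IsUnit A.det) {x y : V → ℝ} (h : A *ᵥ x = y) :
    A⁻¹ *ᵥ y = x := by
  rw [← h, mulVec_mulVec, nonsing_inv_mul _ hA, one_mulVec]

theorem symPinv_isHermitian (hA : A.IsHermitian) : (symPinv hA).IsHermitian := by
  rw [IsHermitian, conjTranspose_eq_transpose_of_trivial]
  simp [symPinv, transpose_mul, Matrix.mul_assoc]

theorem mul_symPinv_mul_self (hA : A.IsHermitian) : A * symPinv hA * A = A := by
  set U : Matrix V V ℝ := (hA.eigenvectorUnitary : Matrix V V ℝ)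
  set D := diagonal hA.eigenvalues with hD
  set D' := diagonal fun i => (hA.eigenvalues i)⁻¹ with hD'
  have U_orthogonal : Uᵀ * U = 1 := by
    simpa [star_eq_conjTranspose, conjTranspose_eq_transpose_of_trivial] using
      Unitary.coe_star_mul_self hA.eigenvectorUnitary
  have A_eq : A = U * D * Uᵀ := by
    simpa [Unitary.conjStarAlgAut_apply, star_eq_conjTranspose,
      conjTranspose_eq_transpose_of_trivial] using hA.spectral_theorem
  have D_mul : D * D' * D = D := by
    simp [hD, hD', diagonal_mul_diagonal, mul_inv_mul_cancel]
  calc A * symPinv hA * A = U * D * Uᵀ * (U * D' * Uᵀ) * (U * D * Uᵀ) := by rw [← A_eq, symPinv]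
    _ = U * (D * (Uᵀ * U) * D' * (Uᵀ * U) * D) * Uᵀ := by simp only [Matrix.mul_assoc]
    _ = A := by rw [U_orthogonal, Matrix.mul_one, Matrix.mul_one, D_mul, ← A_eq]

theorem mulVec_symPinv_mulVec (hA : A.IsHermitian) {e : V → ℝ}
    (he : ∀ x, A *ᵥ x = 0 → e ⬝ᵥ x = 0) : A *ᵥ (symPinv hA *ᵥ e) = e := by
  refine dotProduct_eq _ _ fun x => ?_
  have hker : A *ᵥ (x - symPinv hA *ᵥ (A *ᵥ x)) = 0 := by
    rw [mulVec_sub, mulVec_mulVec, mulVec_mulVec, mul_symPinv_mul_self, sub_self]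
  calc (A *ᵥ (symPinv hA *ᵥ e)) ⬝ᵥ x = (A *ᵥ x) ⬝ᵥ symPinv hA *ᵥ e := by
        rw [dotProduct_comm, dotProduct_mulVec_comm hA, dotProduct_comm]
    _ = e ⬝ᵥ symPinv hA *ᵥ (A *ᵥ x) := dotProduct_mulVec_comm (symPinv_isHermitian hA) _ _
    _ = e ⬝ᵥ x := (sub_eq_zero.mp (by rw [← dotProduct_sub, he _ hker])).symm

end LinearAlgebra

theorem sum_ite_sym2Mk_eq {V : Type*} [Fintype V] [DecidableEq V] (f : V → V → ℝ) (i j k : V) :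
    ∑ l, (if s(k, l) = s(i, j) then f k l else 0) =
      if k = i then f i j else if k = j then f j i else 0 := by
  split_ifs with hki hkj
  · simp only [hki, Sym2.congr_right, Finset.sum_ite_eq', Finset.mem_univ, if_true]
  · simp only [hkj, Sym2.eq_swap (a := i), Sym2.congr_right, Finset.sum_ite_eq',
      Finset.mem_univ, if_true]
  · exact Finset.sum_eq_zero fun l _ => if_neg (by simp [hki, hkj])

namespace PowerNetwork

section Lines

variable {V : Type*} (N : PowerNetwork V)

theorem b_mul_sq_nonneg (x : V → ℝ) (i j : V) : 0 ≤ N.b i j * (x i - x j) ^ 2 :=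
  mul_nonneg (N.nonneg i j) (sq_nonneg _)

/-- The network without the line between `i` and `j`. -/
def deleteLine [DecidableEq V] (i j : V) : PowerNetwork V where
  b k l := if s(k, l) = s(i, j) then 0 else N.b k l
  symm k l := by rw [Sym2.eq_swap (a := k), N.symm]
  nonneg k l := by split_ifs; exacts [le_rfl, N.nonneg k l]
  diag_zero k := by simp [N.diag_zero]

variable {N} {i j : V}

theorem IsNonsplittingLine.connected (h : N.IsNonsplittingLine i j) : N.graph.Connected :=
  h.2.mono (SimpleGraph.deleteEdges_le _)

theorem IsNonsplittingLine.deleteLine_connected [DecidableEq V] (h : N.IsNonsplittingLine i j) :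
    (N.deleteLine i j).graph.Connected := by
  refine h.2.mono fun k l hkl => ?_
  rw [SimpleGraph.deleteEdges_adj] at hkl
  have hb : (N.deleteLine i j).b k l = N.b k l := if_neg hkl.2
  exact hkl.1.trans_eq hb.symm

end Lines

section Laplacian

variable {V : Type*} [Fintype V] [DecidableEq V] (N : PowerNetwork V)

theorem laplacian_mulVec_apply (x : V → ℝ) (i : V) :
    (N.laplacian *ᵥ x) i = ∑ j, N.b i j * (x i - x j) := by
  rw [laplacian, sub_mulVec, Pi.sub_apply, mulVec_diagonal, Finset.sum_mul]
  simp only [mul_sub, Finset.sum_sub_distrib]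
  rfl

theorem two_mul_dotProduct_laplacian_mulVec (x : V → ℝ) :
    2 * (x ⬝ᵥ N.laplacian *ᵥ x) = ∑ i, ∑ j, N.b i j * (x i - x j) ^ 2 := by
  have h : x ⬝ᵥ N.laplacian *ᵥ x = ∑ i, ∑ j, x i * (N.b i j * (x i - x j)) := by
    simp only [dotProduct, laplacian_mulVec_apply, Finset.mul_sum]
  have hswap : x ⬝ᵥ N.laplacian *ᵥ x = ∑ i, ∑ j, x j * (N.b i j * (x j - x i)) := by
    rw [h, Finset.sum_comm]
    simp only [N.symm]
  rw [two_mul]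
  nth_rw 1 [h]
  rw [hswap]
  simp only [← Finset.sum_add_distrib]
  exact Finset.sum_congr rfl fun i _ => Finset.sum_congr rfl fun j _ => by ring

theorem laplacian_posSemidef : N.laplacian.PosSemidef := by
  refine PosSemidef.of_dotProduct_mulVec_nonneg N.laplacian_isHermitian fun x => ?_
  have hsum : 0 ≤ 2 * (x ⬝ᵥ N.laplacian *ᵥ x) := by
    rw [two_mul_dotProduct_laplacian_mulVec]
    exact Finset.sum_nonneg fun i _ => Finset.sum_nonneg fun j _ => N.b_mul_sq_nonneg x i j
  simpa using hsum

theorem eq_of_adj_of_dotProduct_laplacian_mulVec_eq_zero {x : V → ℝ}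
    (hx : x ⬝ᵥ N.laplacian *ᵥ x = 0) {i j : V} (hij : N.graph.Adj i j) : x i = x j := by
  have hterm : N.b i j * (x i - x j) ^ 2 = 0 := by
    have hsum := (N.two_mul_dotProduct_laplacian_mulVec x).symm
    rw [hx, mul_zero, Finset.sum_eq_zero_iff_of_nonneg fun i _ =>
      Finset.sum_nonneg fun j _ => N.b_mul_sq_nonneg x i j] at hsum
    exact (Finset.sum_eq_zero_iff_of_nonneg fun j _ => N.b_mul_sq_nonneg x i j).mp
      (hsum i (Finset.mem_univ i)) j (Finset.mem_univ j)
  have hb : N.b i j ≠ 0 := ne_of_gt hij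
  simpa [hb, sub_eq_zero] using hterm

theorem eq_of_dotProduct_laplacian_mulVec_eq_zero (hN : N.graph.Connected) {x : V → ℝ}
    (hx : x ⬝ᵥ N.laplacian *ᵥ x = 0) (i j : V) : x i = x j := by
  obtain ⟨p⟩ := hN.preconnected i j
  induction p with
  | nil => rfl
  | cons hadj _ ih => exact (N.eq_of_adj_of_dotProduct_laplacian_mulVec_eq_zero hx hadj).trans ih

theorem laplacian_mulVec_symPinv_edgeVec (hN : N.graph.Connected) (i j : V) :
    N.laplacian *ᵥ (symPinv N.laplacian_isHermitian *ᵥ edgeVec i j) = edgeVec i j := by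
  refine mulVec_symPinv_mulVec _ fun x hx => ?_
  rw [edgeVec_dotProduct, sub_eq_zero]
  exact N.eq_of_dotProduct_laplacian_mulVec_eq_zero hN (by rw [hx, dotProduct_zero]) i j

theorem laplacian_deleteLine {i j : V} (hij : i ≠ j) :
    (N.deleteLine i j).laplacian = N.faultedLaplacian i j := by
  suffices h : ∀ x k, ((N.deleteLine i j).laplacian *ᵥ x) k = (N.faultedLaplacian i j *ᵥ x) k from
    Matrix.ext_of_mulVec_single fun _ => funext (h _)
  intro x k
  calc ((N.deleteLine i j).laplacian *ᵥ x) k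
      = ∑ l, N.b k l * (x k - x l) -
          ∑ l, (if s(k, l) = s(i, j) then N.b k l * (x k - x l) else 0) := by
        rw [laplacian_mulVec_apply, ← Finset.sum_sub_distrib]
        exact Finset.sum_congr rfl fun l _ => by simp only [deleteLine]; split_ifs <;> ring
    _ = (N.laplacian *ᵥ x) k - N.b i j * ((x i - x j) * edgeVec i j k) := by
        rw [laplacian_mulVec_apply, sum_ite_sym2Mk_eq fun k l => N.b k l * (x k - x l),
          N.symm j i]
        by_cases hki : k = i
        · simp [edgeVec, hki, hij]
        by_cases hkj : k = j
        · simp [edgeVec, hkj, hij.symm, mul_sub]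
        · simp [edgeVec, hki, hkj]
    _ = (N.faultedLaplacian i j *ᵥ x) k := by
        rw [faultedLaplacian, sub_mulVec, smul_mulVec, vecMulVec_mulVec, edgeVec_dotProduct]
        simp [mul_comm (edgeVec i j k)]

theorem laplacian_sub_faultedLaplacian_mulVec (θ : V → ℝ) (i j : V) :
    (N.laplacian - N.faultedLaplacian i j) *ᵥ θ = N.lineFlow θ i j • edgeVec i j := by
  rw [faultedLaplacian, sub_sub_cancel, smul_mulVec, vecMulVec_mulVec, edgeVec_dotProduct,
    op_smul_eq_smul, smul_smul, lineFlow]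

end Laplacian

section PassiveBlock

variable {G C : Type*} [Fintype G] [Fintype C] [DecidableEq G] [DecidableEq C] [Nonempty G]
  {N : PowerNetwork (G ⊕ C)}

theorem laplacian_toBlocks₂₂_posDef (hN : N.graph.Connected) :
    N.laplacian.toBlocks₂₂.PosDef := by
  have hpsd : N.laplacian.toBlocks₂₂.PosSemidef := N.laplacian_posSemidef.submatrix Sum.inr
  refine PosDef.of_dotProduct_mulVec_pos hpsd.1 fun x hx => ?_
  refine (hpsd.dotProduct_mulVec_nonneg x).lt_of_ne fun hform => hx ?_
  have hform' : Sum.elim (0 : G → ℝ) x ⬝ᵥ N.laplacian *ᵥ Sum.elim (0 : G → ℝ) x = 0 := by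
    rw [← fromBlocks_toBlocks N.laplacian, fromBlocks_mulVec]
    simpa [Sum.elim_comp_inl, Sum.elim_comp_inr] using hform.symm
  obtain ⟨g⟩ := ‹Nonempty G›
  ext k
  exact N.eq_of_dotProduct_laplacian_mulVec_eq_zero hN hform' (Sum.inr k) (Sum.inl g)

theorem isUnit_det_laplacian_toBlocks₂₂ (hN : N.graph.Connected) :
    IsUnit N.laplacian.toBlocks₂₂.det :=
  (isUnit_iff_isUnit_det _).mp (laplacian_toBlocks₂₂_posDef hN).isUnit

theorem IsNonsplittingLine.kronReducible {i j : G ⊕ C} (h : N.IsNonsplittingLine i j) :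
    KronReducible N i j := by
  refine ⟨isUnit_det_laplacian_toBlocks₂₂ h.connected, ?_⟩
  rw [← N.laplacian_deleteLine h.1.ne]
  exact isUnit_det_laplacian_toBlocks₂₂ h.deleteLine_connected

end PassiveBlock

end PowerNetwork

section Kron

variable {G C : Type*} {A : Matrix (G ⊕ C) (G ⊕ C) ℝ}

theorem eq_fromBlocks_of_isHermitian (hA : A.IsHermitian) :
    A = fromBlocks A.toBlocks₁₁ A.toBlocks₁₂ A.toBlocks₁₂ᴴ A.toBlocks₂₂ := by
  have hblocks := hA
  rw [← fromBlocks_toBlocks A, isHermitian_fromBlocks_iff] at hblocks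
  rw [hblocks.2.1, fromBlocks_toBlocks]

section MulVec

variable [Fintype G] [Fintype C]

theorem mulVec_comp_inl (A : Matrix (G ⊕ C) (G ⊕ C) ℝ) (x : G ⊕ C → ℝ) :
    (A *ᵥ x) ∘ Sum.inl = A.toBlocks₁₁ *ᵥ (x ∘ Sum.inl) + A.toBlocks₁₂ *ᵥ (x ∘ Sum.inr) :=
  funext fun _ => Fintype.sum_sum_type _

theorem mulVec_comp_inr (A : Matrix (G ⊕ C) (G ⊕ C) ℝ) (x : G ⊕ C → ℝ) :
    (A *ᵥ x) ∘ Sum.inr = A.toBlocks₂₁ *ᵥ (x ∘ Sum.inl) + A.toBlocks₂₂ *ᵥ (x ∘ Sum.inr) :=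
  funext fun _ => Fintype.sum_sum_type _

end MulVec

variable [Fintype C] [DecidableEq C]

theorem kronMatrix_posSemidef [Finite G] (hA : A.PosSemidef) (hA₂₂ : A.toBlocks₂₂.PosDef) :
    (kronMatrix A).PosSemidef := by
  have := Fintype.ofFinite G
  have : Invertible A.toBlocks₂₂ := hA₂₂.isUnit.invertible
  have hblocks := eq_fromBlocks_of_isHermitian hA.1
  have hA₂₁ : A.toBlocks₂₁ = A.toBlocks₁₂ᴴ := congrArg toBlocks₂₁ hblocks
  rw [kronMatrix, hA₂₁, ← hA₂₂.fromBlocks₂₂, ← hblocks]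
  exact hA

/-- The quadratic form `e_cᵀ (A^cc)⁻¹ e_c` of the passive part `e_c` of `e`. For `A` the Laplacian
and `e = e_(α,β)` it is the amount by which Kron reduction lowers the resistance distance. -/
def passiveForm (A : Matrix (G ⊕ C) (G ⊕ C) ℝ) (e : G ⊕ C → ℝ) : ℝ :=
  (e ∘ Sum.inr) ⬝ᵥ A.toBlocks₂₂⁻¹ *ᵥ (e ∘ Sum.inr)

theorem kronInjection_eq_of_mulVec_eq (hA : IsUnit A.toBlocks₂₂.det) {P : G ⊕ C → ℝ} {x : C → ℝ}
    (h : A.toBlocks₂₂ *ᵥ x = P ∘ Sum.inr) :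
    kronInjection A P = P ∘ Sum.inl - A.toBlocks₁₂ *ᵥ x := by
  rw [kronInjection, ← mulVec_mulVec]
  exact congrArg (fun v => P ∘ Sum.inl - A.toBlocks₁₂ *ᵥ v) (inv_mulVec_eq_of_mulVec_eq hA h)

theorem kronInjection_smul (A : Matrix (G ⊕ C) (G ⊕ C) ℝ) (c : ℝ) (P : G ⊕ C → ℝ) :
    kronInjection A (c • P) = c • kronInjection A P := by
  simp only [kronInjection, smul_sub, ← mulVec_smul]
  rfl

theorem kronInjection_sub (A : Matrix (G ⊕ C) (G ⊕ C) ℝ) (P Q : G ⊕ C → ℝ) :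
    kronInjection A (P - Q) = kronInjection A P - kronInjection A Q := by
  simp only [kronInjection, sub_sub_sub_comm, ← mulVec_sub]
  rfl

section OperatingPoint

variable [Fintype G]

theorem kronInjection_mulVec (hA : IsUnit A.toBlocks₂₂.det) (x : G ⊕ C → ℝ) :
    kronInjection A (A *ᵥ x) = kronMatrix A *ᵥ (x ∘ Sum.inl) := by
  have hsolve : A.toBlocks₂₂ *ᵥ (A.toBlocks₂₂⁻¹ *ᵥ (A.toBlocks₂₁ *ᵥ (x ∘ Sum.inl)) +
      x ∘ Sum.inr) = (A *ᵥ x) ∘ Sum.inr := by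
    rw [mulVec_add, mulVec_mulVec, mul_nonsing_inv _ hA, one_mulVec, mulVec_comp_inr]
  rw [kronInjection_eq_of_mulVec_eq hA hsolve, mulVec_comp_inl, kronMatrix, sub_mulVec,
    ← mulVec_mulVec, ← mulVec_mulVec, mulVec_add]
  abel

theorem dotProduct_mulVec_eq_kronMatrix_add_passiveForm (hA : A.IsHermitian)
    (hA₂₂ : IsUnit A.toBlocks₂₂.det) (x : G ⊕ C → ℝ) :
    x ⬝ᵥ A *ᵥ x =
      (x ∘ Sum.inl) ⬝ᵥ kronMatrix A *ᵥ (x ∘ Sum.inl) + passiveForm A (A *ᵥ x) := by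
  set xg := x ∘ Sum.inl with hxg
  set xc := x ∘ Sum.inr
  set u := A.toBlocks₂₂⁻¹ *ᵥ ((A *ᵥ x) ∘ Sum.inr) with hu
  have hsolve : A.toBlocks₂₂ *ᵥ u = (A *ᵥ x) ∘ Sum.inr := by
    rw [hu, mulVec_mulVec, mul_nonsing_inv _ hA₂₂, one_mulVec]
  have hkron : kronMatrix A *ᵥ xg = (A *ᵥ x) ∘ Sum.inl - A.toBlocks₁₂ *ᵥ u := by
    rw [hxg, ← kronInjection_mulVec hA₂₂, kronInjection_eq_of_mulVec_eq hA₂₂ hsolve]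
  have hcross : xg ⬝ᵥ A.toBlocks₁₂ *ᵥ u = (A.toBlocks₂₁ *ᵥ xg) ⬝ᵥ u := by
    have hA₂₁ : A.toBlocks₂₁ = A.toBlocks₁₂ᵀ := by
      rw [← conjTranspose_eq_transpose_of_trivial]
      exact congrArg toBlocks₂₁ (eq_fromBlocks_of_isHermitian hA)
    rw [dotProduct_mulVec, ← mulVec_transpose, hA₂₁]
  have hpassive : passiveForm A (A *ᵥ x) = xg ⬝ᵥ A.toBlocks₁₂ *ᵥ u + xc ⬝ᵥ (A *ᵥ x) ∘ Sum.inr := by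
    rw [passiveForm, ← hu, mulVec_comp_inr, add_dotProduct, hcross, ← mulVec_comp_inr, ← hsolve,
      dotProduct_mulVec_comm (A := A.toBlocks₂₂) (hA.submatrix Sum.inr), dotProduct_comm u]
  calc x ⬝ᵥ A *ᵥ x = xg ⬝ᵥ (A *ᵥ x) ∘ Sum.inl + xc ⬝ᵥ (A *ᵥ x) ∘ Sum.inr := Fintype.sum_sum_type _
    _ = xg ⬝ᵥ kronMatrix A *ᵥ xg + passiveForm A (A *ᵥ x) := by
      rw [hkron, hpassive, dotProduct_sub]; ring

theorem kronInjection_sub_sub_kronMatrix_mulVec {B : Matrix (G ⊕ C) (G ⊕ C) ℝ}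
    (hA : IsUnit A.toBlocks₂₂.det) (hB : IsUnit B.toBlocks₂₂.det) (x : G ⊕ C → ℝ) :
    (kronInjection B (A *ᵥ x) - kronInjection A (A *ᵥ x)) -
        (kronMatrix B - kronMatrix A) *ᵥ (x ∘ Sum.inl) =
      kronInjection B ((A - B) *ᵥ x) := by
  rw [sub_mulVec, sub_mulVec, kronInjection_sub, kronInjection_mulVec hA, kronInjection_mulVec hB]
  abel

end OperatingPoint

section RankOneUpdate

variable {e : G ⊕ C → ℝ} {b : ℝ}

theorem toBlocks₂₂_sub_vecMulVec_mulVec (hA : IsUnit A.toBlocks₂₂.det) :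
    (A - b • vecMulVec e e).toBlocks₂₂ *ᵥ (A.toBlocks₂₂⁻¹ *ᵥ (e ∘ Sum.inr)) =
      (1 - b * passiveForm A e) • (e ∘ Sum.inr) := by
  change (A.toBlocks₂₂ - b • vecMulVec (e ∘ Sum.inr) (e ∘ Sum.inr)) *ᵥ _ = _
  rw [sub_mulVec, mulVec_mulVec, mul_nonsing_inv _ hA, one_mulVec, smul_mulVec, vecMulVec_mulVec,
    op_smul_eq_smul, sub_smul, one_smul, mul_smul]
  rfl

theorem one_sub_mul_passiveForm_ne_zero (hA : IsUnit A.toBlocks₂₂.det)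
    (hB : IsUnit (A - b • vecMulVec e e).toBlocks₂₂.det) : 1 - b * passiveForm A e ≠ 0 := by
  intro hzero
  have hsolve := toBlocks₂₂_sub_vecMulVec_mulVec (e := e) (b := b) hA
  rw [hzero, zero_smul] at hsolve
  have hker : A.toBlocks₂₂⁻¹ *ᵥ (e ∘ Sum.inr) = 0 := by
    rw [← inv_mulVec_eq_of_mulVec_eq hB hsolve, mulVec_zero]
  simp [passiveForm, hker] at hzero

theorem kronInjection_sub_vecMulVec (hA : IsUnit A.toBlocks₂₂.det)
    (hB : IsUnit (A - b • vecMulVec e e).toBlocks₂₂.det) :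
    kronInjection (A - b • vecMulVec e e) e =
      (1 - b * passiveForm A e)⁻¹ • kronInjection A e := by
  set u := A.toBlocks₂₂⁻¹ *ᵥ (e ∘ Sum.inr) with hu
  set c := 1 - b * passiveForm A e with hc
  have hc0 : c ≠ 0 := one_sub_mul_passiveForm_ne_zero hA hB
  have hsolve : (A - b • vecMulVec e e).toBlocks₂₂ *ᵥ (c⁻¹ • u) = e ∘ Sum.inr := by
    rw [mulVec_smul, toBlocks₂₂_sub_vecMulVec_mulVec hA, inv_smul_smul₀ hc0]
  have hsolve' : A.toBlocks₂₂ *ᵥ u = e ∘ Sum.inr := by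
    rw [hu, mulVec_mulVec, mul_nonsing_inv _ hA, one_mulVec]
  have hblock : (A - b • vecMulVec e e).toBlocks₁₂ *ᵥ u =
      A.toBlocks₁₂ *ᵥ u - (1 - c) • (e ∘ Sum.inl) := by
    change (A.toBlocks₁₂ - b • vecMulVec (e ∘ Sum.inl) (e ∘ Sum.inr)) *ᵥ u = _
    rw [sub_mulVec, smul_mulVec, vecMulVec_mulVec, op_smul_eq_smul, hc, sub_sub_cancel, mul_smul]
    rfl
  rw [kronInjection_eq_of_mulVec_eq hB hsolve, kronInjection_eq_of_mulVec_eq hA hsolve',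
    mulVec_smul, hblock, eq_inv_smul_iff₀ hc0, smul_sub, smul_inv_smul₀ hc0]
  module

end RankOneUpdate

section EdgeVec

variable [DecidableEq G] (A : Matrix (G ⊕ C) (G ⊕ C) ℝ)

theorem passiveForm_edgeVec_inl_inl (α β : G) :
    passiveForm A (edgeVec (Sum.inl α) (Sum.inl β)) = 0 := by
  have hpassive : edgeVec (Sum.inl α : G ⊕ C) (Sum.inl β) ∘ Sum.inr = 0 := by
    ext k; simp [edgeVec]
  rw [passiveForm, hpassive, zero_dotProduct]

theorem passiveForm_edgeVec_inr_inr (α β : C) :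
    passiveForm A (edgeVec (Sum.inr α) (Sum.inr β)) =
      edgeVec α β ⬝ᵥ A.toBlocks₂₂⁻¹ *ᵥ edgeVec α β := by
  have hpassive : edgeVec (Sum.inr α : G ⊕ C) (Sum.inr β) ∘ Sum.inr = edgeVec α β := by
    ext k; simp [edgeVec, Pi.single_apply]
  rw [passiveForm, hpassive]

theorem passiveForm_edgeVec_inl_inr (α : G) (β : C) :
    passiveForm A (edgeVec (Sum.inl α) (Sum.inr β)) = A.toBlocks₂₂⁻¹ β β := by
  have hpassive : edgeVec (Sum.inl α : G ⊕ C) (Sum.inr β) ∘ Sum.inr = -Pi.single β 1 := by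
    ext k; simp [edgeVec, Pi.single_apply]
  simp [passiveForm, hpassive, mulVec_neg]

end EdgeVec

end Kron

section Regularization

variable {V : Type*} [DecidableEq V] {L : Matrix V V ℝ}

theorem add_smul_one_posDef (hL : L.PosSemidef) {ε : ℝ} (hε : 0 < ε) :
    (L + ε • (1 : Matrix V V ℝ)).PosDef :=
  PosDef.posSemidef_add hL (PosDef.one.smul hε)

variable [Fintype V]

theorem dotProduct_inv_add_smul_one_mem_Icc (hL : L.PosSemidef) (y : V → ℝ) {ε : ℝ} (hε : 0 < ε) :
    (L *ᵥ y) ⬝ᵥ (L + ε • (1 : Matrix V V ℝ))⁻¹ *ᵥ (L *ᵥ y) ∈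
      Set.Icc (y ⬝ᵥ L *ᵥ y - ε * (y ⬝ᵥ y)) (y ⬝ᵥ L *ᵥ y) := by
  have hunit := (add_smul_one_posDef hL hε).isUnit
  have hdet := (isUnit_iff_isUnit_det _).mp hunit
  obtain ⟨z, hz⟩ : ∃ z, (L + ε • (1 : Matrix V V ℝ)) *ᵥ z = y :=
    mulVec_surjective_iff_isUnit.mpr hunit y
  have hy : y = L *ᵥ z + ε • z := by rw [← hz, add_mulVec, smul_mulVec, one_mulVec]
  have hinv : (L + ε • (1 : Matrix V V ℝ))⁻¹ *ᵥ (L *ᵥ y) = y - ε • z := by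
    refine inv_mulVec_eq_of_mulVec_eq hdet ?_
    rw [mulVec_sub, mulVec_smul, hz, add_mulVec, smul_mulVec, one_mulVec, add_sub_cancel_right]
  have hvalue : (L *ᵥ y) ⬝ᵥ (y - ε • z) = y ⬝ᵥ L *ᵥ y - ε * (y ⬝ᵥ L *ᵥ z) := by
    rw [dotProduct_sub, dotProduct_smul, smul_eq_mul, dotProduct_comm, dotProduct_comm _ z,
      dotProduct_mulVec_comm hL.1 z]
  have hform : 0 ≤ z ⬝ᵥ L *ᵥ z := hL.dotProduct_mulVec_nonneg z
  have hupper : 0 ≤ y ⬝ᵥ L *ᵥ z := by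
    rw [hy, add_dotProduct, smul_dotProduct]
    exact add_nonneg (dotProduct_self_nonneg _) (mul_nonneg hε.le hform)
  have hlower : y ⬝ᵥ L *ᵥ z ≤ y ⬝ᵥ y := by
    have hyz : 0 ≤ y ⬝ᵥ z := by
      rw [hy, add_dotProduct, smul_dotProduct, dotProduct_comm]
      exact add_nonneg hform (mul_nonneg hε.le (dotProduct_self_nonneg _))
    nth_rw 3 [hy]
    rw [dotProduct_add, dotProduct_smul]
    exact le_add_of_nonneg_right (mul_nonneg hε.le hyz)
  rw [hinv, hvalue]
  exact ⟨by gcongr, sub_le_self _ (mul_nonneg hε.le hupper)⟩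

theorem tendsto_dotProduct_inv_add_smul_one (hL : L.PosSemidef) (y : V → ℝ) :
    Tendsto (fun ε : ℝ => (L *ᵥ y) ⬝ᵥ (L + ε • (1 : Matrix V V ℝ))⁻¹ *ᵥ (L *ᵥ y)) (𝓝[>] 0)
      (𝓝 (y ⬝ᵥ L *ᵥ y)) := by
  have hlower : Tendsto (fun ε : ℝ => y ⬝ᵥ L *ᵥ y - ε * (y ⬝ᵥ y)) (𝓝[>] 0)
      (𝓝 (y ⬝ᵥ L *ᵥ y)) := by
    have hcont : Continuous fun ε : ℝ => y ⬝ᵥ L *ᵥ y - ε * (y ⬝ᵥ y) := by fun_prop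
    simpa using (hcont.tendsto 0).mono_left nhdsWithin_le_nhds
  refine tendsto_of_tendsto_of_tendsto_of_le_of_le' hlower tendsto_const_nhds ?_ ?_ <;>
    filter_upwards [self_mem_nhdsWithin] with ε hε
  · exact (dotProduct_inv_add_smul_one_mem_Icc hL y hε).1
  · exact (dotProduct_inv_add_smul_one_mem_Icc hL y hε).2

end Regularization

theorem tendsto_zero_of_hasDerivAt_le_neg_mul {f f' : ℝ → ℝ} {c : ℝ} (hc : 0 < c)
    (hf : ∀ t, HasDerivAt f (f' t) t) (hnonneg : ∀ t, 0 ≤ f t) (hle : ∀ t, f' t ≤ -(c * f t)) :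
    Tendsto f atTop (𝓝 0) := by
  have hexp : ∀ t, HasDerivAt (fun t => Real.exp (c * t)) (Real.exp (c * t) * c) t := fun t => by
    simpa only [id, mul_one] using ((hasDerivAt_id t).const_mul c).exp
  have hderiv : ∀ t, HasDerivAt (fun t => f t * Real.exp (c * t))
      ((f' t + c * f t) * Real.exp (c * t)) t := fun t =>
    ((hf t).mul (hexp t)).congr_deriv (by ring)
  have hanti : Antitone fun t => f t * Real.exp (c * t) :=
    antitone_of_hasDerivAt_nonpos hderiv fun t =>
      mul_nonpos_of_nonpos_of_nonneg (by linarith [hle t]) (Real.exp_pos _).le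
  have hbound : ∀ t, 0 ≤ t → f t ≤ f 0 * Real.exp (-(c * t)) := fun t ht => by
    have hle₀ := hanti ht
    simp only [mul_zero, Real.exp_zero, mul_one] at hle₀
    rwa [Real.exp_neg, ← div_eq_mul_inv, le_div_iff₀ (Real.exp_pos _)]
  have hlim : Tendsto (fun t => f 0 * Real.exp (-(c * t))) atTop (𝓝 0) := by
    have harg : Tendsto (fun t : ℝ => -(c * t)) atTop atBot :=
      tendsto_neg_atTop_atBot.comp (tendsto_id.const_mul_atTop hc)
    simpa using (Real.tendsto_exp_atBot.comp harg).const_mul (f 0)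
  exact squeeze_zero' (Eventually.of_forall hnonneg)
    ((eventually_ge_atTop 0).mono hbound) hlim

section QuadraticForms

variable {V : Type*} [Fintype V]

theorem dotProduct_mulVec_self_le (M : Matrix V V ℝ) (x : V → ℝ) :
    x ⬝ᵥ M *ᵥ x ≤ (∑ i, ∑ j, |M i j|) * (x ⬝ᵥ x) := by
  have hcoord : ∀ i, x i ^ 2 ≤ x ⬝ᵥ x := fun i => by
    rw [sq]
    exact Finset.single_le_sum (fun k _ => mul_self_nonneg (x k)) (Finset.mem_univ i)
  have hprod : ∀ i j, |x i * x j| ≤ x ⬝ᵥ x := fun i j => by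
    rw [abs_mul]
    nlinarith [hcoord i, hcoord j, two_mul_le_add_sq |x i| |x j|, sq_abs (x i), sq_abs (x j)]
  have hterm : ∀ i j, x i * (M i j * x j) ≤ |M i j| * (x ⬝ᵥ x) := fun i j =>
    calc x i * (M i j * x j) ≤ |M i j * (x i * x j)| := (le_abs_self _).trans_eq' (by ring)
      _ ≤ |M i j| * (x ⬝ᵥ x) := by rw [abs_mul]; gcongr; exact hprod i j
  calc x ⬝ᵥ M *ᵥ x = ∑ i, ∑ j, x i * (M i j * x j) := by
        simp only [dotProduct, mulVec, Finset.mul_sum]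
    _ ≤ ∑ i, ∑ j, |M i j| * (x ⬝ᵥ x) :=
        Finset.sum_le_sum fun i _ => Finset.sum_le_sum fun j _ => hterm i j
    _ = (∑ i, ∑ j, |M i j|) * (x ⬝ᵥ x) := by simp only [Finset.sum_mul]

variable {u : ℝ → V → ℝ} {u' : V → ℝ} {t : ℝ}

theorem hasDerivAt_dotProduct_mulVec_self {M : Matrix V V ℝ} (hM : M.IsHermitian)
    (hu : HasDerivAt u u' t) :
    HasDerivAt (fun s => u s ⬝ᵥ M *ᵥ u s) (2 * (u' ⬝ᵥ M *ᵥ u t)) t := by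
  have hderiv : HasDerivAt (fun s => u s ⬝ᵥ M *ᵥ u s) (u' ⬝ᵥ M *ᵥ u t + u t ⬝ᵥ M *ᵥ u') t := by
    rw [hasDerivAt_pi] at hu
    simp only [dotProduct, mulVec, ← Finset.sum_add_distrib]
    exact HasDerivAt.fun_sum fun i _ =>
      (hu i).mul (HasDerivAt.fun_sum fun j _ => (hu j).const_mul (M i j))
  rwa [dotProduct_mulVec_comm hM (u t), ← two_mul] at hderiv

theorem hasDerivAt_dotProduct_self (hu : HasDerivAt u u' t) :
    HasDerivAt (fun s => u s ⬝ᵥ u s) (2 * (u' ⬝ᵥ u t)) t := by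
  classical
  simpa only [one_mulVec] using hasDerivAt_dotProduct_mulVec_self isHermitian_one hu

end QuadraticForms

section Swing

variable {V : Type*} [Fintype V] {K : Matrix V V ℝ} {m d : ℝ}

/-- The energy of `m φ'' = -d φ' - K φ` at angles `φ` and frequencies `ω`; damping dissipates it
at the rate `d ωᵀ ω`. -/
def swingEnergy (K : Matrix V V ℝ) (m : ℝ) (φ ω : V → ℝ) : ℝ :=
  (m * (ω ⬝ᵥ ω) + φ ⬝ᵥ K *ᵥ φ) / 2

/-- A storage function of `m φ'' = -d φ' - K φ` which decreases at the rate `φᵀ φ`. It is built on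
`p = d φ + m ω`, which satisfies `p' = -K φ`. -/
def angleStorage [DecidableEq V] (K : Matrix V V ℝ) (m d : ℝ) (φ ω : V → ℝ) : ℝ :=
  ((d • φ + m • ω) ⬝ᵥ K⁻¹ *ᵥ (d • φ + m • ω) + m * (φ ⬝ᵥ φ)) / (2 * d)

theorem swingEnergy_nonneg (hK : K.PosSemidef) (hm : 0 ≤ m) (φ ω : V → ℝ) :
    0 ≤ swingEnergy K m φ ω := by
  have hform : 0 ≤ φ ⬝ᵥ K *ᵥ φ := hK.dotProduct_mulVec_nonneg φ
  have hω := dotProduct_self_nonneg ω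
  unfold swingEnergy
  positivity

theorem angleStorage_nonneg [DecidableEq V] (hK : K.PosSemidef) (hm : 0 ≤ m) (hd : 0 ≤ d)
    (φ ω : V → ℝ) : 0 ≤ angleStorage K m d φ ω := by
  have hform : 0 ≤ (d • φ + m • ω) ⬝ᵥ K⁻¹ *ᵥ (d • φ + m • ω) :=
    hK.inv.dotProduct_mulVec_nonneg _
  have hφ := dotProduct_self_nonneg φ
  unfold angleStorage
  positivity

theorem exists_angleStorage_add_swingEnergy_le [DecidableEq V] (K : Matrix V V ℝ) (hm : 0 < m)
    (hd : 0 < d) :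
    ∃ B, 0 < B ∧ ∀ φ ω : V → ℝ,
      angleStorage K m d φ ω + swingEnergy K m φ ω ≤ B * (φ ⬝ᵥ φ + ω ⬝ᵥ ω) := by
  set a := ∑ i, ∑ j, |K⁻¹ i j|
  set k := ∑ i, ∑ j, |K i j|
  have ha : 0 ≤ a := by positivity
  have hk : 0 ≤ k := by positivity
  refine ⟨(2 * a * (d ^ 2 + m ^ 2) + m) / (2 * d) + (m + k) / 2, by positivity, fun φ ω => ?_⟩
  have hφ := dotProduct_self_nonneg φ
  have hω := dotProduct_self_nonneg ω
  have hp : (d • φ + m • ω) ⬝ᵥ (d • φ + m • ω) ≤ 2 * (d ^ 2 + m ^ 2) * (φ ⬝ᵥ φ + ω ⬝ᵥ ω) := by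
    have hsub := dotProduct_self_nonneg (d • φ - m • ω)
    simp only [add_dotProduct, dotProduct_add, sub_dotProduct, dotProduct_sub, smul_dotProduct,
      dotProduct_smul, smul_eq_mul, dotProduct_comm ω φ] at hsub ⊢
    nlinarith [mul_nonneg (sq_nonneg d) hω, mul_nonneg (sq_nonneg m) hφ]
  have hstorage : angleStorage K m d φ ω ≤
      (2 * a * (d ^ 2 + m ^ 2) + m) / (2 * d) * (φ ⬝ᵥ φ + ω ⬝ᵥ ω) := by
    rw [angleStorage, div_mul_eq_mul_div]
    gcongr
    nlinarith [dotProduct_mulVec_self_le K⁻¹ (d • φ + m • ω), mul_le_mul_of_nonneg_left hp ha,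
      mul_nonneg hm.le hω]
  have henergy : swingEnergy K m φ ω ≤ (m + k) / 2 * (φ ⬝ᵥ φ + ω ⬝ᵥ ω) := by
    rw [swingEnergy, div_mul_eq_mul_div]
    gcongr
    nlinarith [dotProduct_mulVec_self_le K φ, mul_nonneg hm.le hφ, mul_nonneg hk hω]
  linarith

section Trajectory

variable {φ ω : ℝ → V → ℝ}

theorem hasDerivAt_swingEnergy (hK : K.IsHermitian) (hm : m ≠ 0) {t : ℝ}
    (hφ : HasDerivAt φ (ω t) t) (hω : HasDerivAt ω (m⁻¹ • (-(d • ω t) - K *ᵥ φ t)) t) :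
    HasDerivAt (fun s => swingEnergy K m (φ s) (ω s)) (-(d * (ω t ⬝ᵥ ω t))) t := by
  refine ((((hasDerivAt_dotProduct_self hω).const_mul m).add
    (hasDerivAt_dotProduct_mulVec_self hK hφ)).div_const 2).congr_deriv ?_
  simp only [smul_dotProduct, sub_dotProduct, neg_dotProduct, smul_eq_mul,
    dotProduct_comm (K *ᵥ φ t)]
  field_simp
  ring

variable [DecidableEq V]

theorem hasDerivAt_angleStorage (hK : K.PosDef) (hm : m ≠ 0) (hd : d ≠ 0) {t : ℝ}
    (hφ : HasDerivAt φ (ω t) t) (hω : HasDerivAt ω (m⁻¹ • (-(d • ω t) - K *ᵥ φ t)) t) :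
    HasDerivAt (fun s => angleStorage K m d (φ s) (ω s)) (-(φ t ⬝ᵥ φ t)) t := by
  have hp : HasDerivAt (fun s => d • φ s + m • ω s) (-(K *ᵥ φ t)) t := by
    refine ((hφ.const_smul d).add (hω.const_smul m)).congr_deriv ?_
    rw [smul_inv_smul₀ hm]
    abel
  have hinv : K⁻¹ *ᵥ (K *ᵥ φ t) = φ t :=
    inv_mulVec_eq_of_mulVec_eq ((isUnit_iff_isUnit_det _).mp hK.isUnit) rfl
  refine (((hasDerivAt_dotProduct_mulVec_self hK.inv.1 hp).add
    ((hasDerivAt_dotProduct_self hφ).const_mul m)).div_const (2 * d)).congr_deriv ?_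
  rw [dotProduct_mulVec_comm hK.inv.1, mulVec_neg, hinv]
  simp only [add_dotProduct, smul_dotProduct, dotProduct_neg, smul_eq_mul]
  field_simp
  ring

theorem tendsto_angleStorage (hK : K.PosDef) (hm : 0 < m) (hd : 0 < d)
    (hφ : ∀ t, HasDerivAt φ (ω t) t)
    (hω : ∀ t, HasDerivAt ω (m⁻¹ • (-(d • ω t) - K *ᵥ φ t)) t) :
    Tendsto (fun t => angleStorage K m d (φ t) (ω t)) atTop (𝓝 0) := by
  obtain ⟨B, hB, hle⟩ := exists_angleStorage_add_swingEnergy_le K hm hd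
  have hc : 0 < min 1 d := lt_min one_pos hd
  have hstorage := fun t => angleStorage_nonneg hK.posSemidef hm.le hd.le (φ t) (ω t)
  have henergy := fun t => swingEnergy_nonneg hK.posSemidef hm.le (φ t) (ω t)
  -- The storage alone controls `φ` but not `ω`; adding the energy makes the decay strict.
  have hdecay : ∀ t, -(φ t ⬝ᵥ φ t) + -(d * (ω t ⬝ᵥ ω t)) ≤
      -(min 1 d / B * (angleStorage K m d (φ t) (ω t) + swingEnergy K m (φ t) (ω t))) := by
    intro t
    have hrate : min 1 d * (φ t ⬝ᵥ φ t + ω t ⬝ᵥ ω t) ≤ φ t ⬝ᵥ φ t + d * (ω t ⬝ᵥ ω t) := by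
      nlinarith [mul_le_mul_of_nonneg_right (min_le_left 1 d) (dotProduct_self_nonneg (φ t)),
        mul_le_mul_of_nonneg_right (min_le_right 1 d) (dotProduct_self_nonneg (ω t))]
    have hscaled : min 1 d / B * (angleStorage K m d (φ t) (ω t) + swingEnergy K m (φ t) (ω t)) ≤
        min 1 d * (φ t ⬝ᵥ φ t + ω t ⬝ᵥ ω t) := by
      rw [div_mul_eq_mul_div, div_le_iff₀ hB, mul_assoc, mul_comm _ B]
      gcongr
      exact hle _ _
    linarith
  refine squeeze_zero hstorage (fun t => le_add_of_nonneg_right (henergy t)) ?_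
  exact tendsto_zero_of_hasDerivAt_le_neg_mul (div_pos hc hB)
    (fun t => (hasDerivAt_angleStorage hK hm.ne' hd.ne' (hφ t) (hω t)).add
      (hasDerivAt_swingEnergy hK.1 hm.ne' (hφ t) (hω t)))
    (fun t => add_nonneg (hstorage t) (henergy t)) hdecay

theorem integral_dotProduct_self_eq_angleStorage (hK : K.PosDef) (hm : 0 < m) (hd : 0 < d)
    (hφ : ∀ t, HasDerivAt φ (ω t) t)
    (hω : ∀ t, HasDerivAt ω (m⁻¹ • (-(d • ω t) - K *ᵥ φ t)) t) :
    IntegrableOn (fun t => φ t ⬝ᵥ φ t) (Set.Ioi 0) ∧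
      ∫ t in Set.Ioi (0 : ℝ), φ t ⬝ᵥ φ t = angleStorage K m d (φ 0) (ω 0) := by
  have hderiv := fun t => hasDerivAt_angleStorage hK hm.ne' hd.ne' (hφ t) (hω t)
  have hnonpos := fun t => neg_nonpos.mpr (dotProduct_self_nonneg (φ t))
  have hlim := tendsto_angleStorage hK hm hd hφ hω
  constructor
  · simpa using (integrableOn_Ioi_deriv_of_nonpos' (a := 0) (fun t _ => hderiv t)
      (fun t _ => hnonpos t) hlim).neg
  · have hvalue := integral_Ioi_of_hasDerivAt_of_nonpos' (a := 0) (fun t _ => hderiv t)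
      (fun t _ => hnonpos t) hlim
    rwa [integral_neg, zero_sub, neg_inj] at hvalue

theorem angleStorage_zero_inv_smul (K : Matrix V V ℝ) (hm : m ≠ 0) (d : ℝ) (J : V → ℝ) :
    angleStorage K m d 0 (m⁻¹ • J) = J ⬝ᵥ K⁻¹ *ᵥ J / (2 * d) := by
  simp [angleStorage, smul_inv_smul₀ hm]

end Trajectory

end Swing

section LinearODE

variable {E : Type*} [NormedAddCommGroup E] [NormedSpace ℝ E] [CompleteSpace E]

theorem hasDerivAt_exp_smul_apply (A : E →L[ℝ] E) (x₀ : E) (t : ℝ) :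
    HasDerivAt (fun s : ℝ => NormedSpace.exp (s • A) x₀) (A (NormedSpace.exp (t • A) x₀)) t := by
  simpa using (hasDerivAt_exp_smul_const' (𝕂 := ℝ) A t).clm_apply (hasDerivAt_const t x₀)

theorem continuous_exp_smul_apply (A : E →L[ℝ] E) (x₀ : E) :
    Continuous fun t : ℝ => NormedSpace.exp (t • A) x₀ :=
  continuous_iff_continuousAt.mpr fun t => (hasDerivAt_exp_smul_apply A x₀ t).continuousAt

theorem exp_smul_apply_eq_add_integral (A : E →L[ℝ] E) (x₀ : E) (t : ℝ) :
    NormedSpace.exp (t • A) x₀ = x₀ + ∫ s in (0 : ℝ)..t, A (NormedSpace.exp (s • A) x₀) := by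
  rw [intervalIntegral.integral_eq_sub_of_hasDerivAt
    (fun s _ => hasDerivAt_exp_smul_apply A x₀ s)
    ((A.continuous.comp (continuous_exp_smul_apply A x₀)).intervalIntegrable 0 t)]
  simp

theorem eqOn_exp_smul_apply_of_hasDerivAt {A : E →L[ℝ] E} {x : ℝ → E}
    (hx : ∀ t, 0 ≤ t → HasDerivAt x (A (x t)) t) :
    Set.EqOn x (fun t => NormedSpace.exp (t • A) (x 0)) (Set.Ici 0) := fun t ht =>
  ODE_solution_unique (v := fun _ => A) (fun _ => A.lipschitz)
    (fun s hs => (hx s hs.1).continuousAt.continuousWithinAt)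
    (fun s hs => (hx s hs.1).hasDerivWithinAt)
    (continuous_exp_smul_apply A (x 0)).continuousOn
    (fun s _ => (hasDerivAt_exp_smul_apply A (x 0) s).hasDerivWithinAt)
    (by simp) ⟨ht, le_rfl⟩

theorem eqOn_exp_smul_apply_iff_integral_eq {A : E →L[ℝ] E} {x : ℝ → E} {x₀ : E}
    (hint : LocallyIntegrable x) :
    Set.EqOn x (fun t => NormedSpace.exp (t • A) x₀) (Set.Ici 0) ↔
      ∀ t, 0 ≤ t → x t = x₀ + ∫ s in (0 : ℝ)..t, A (x s) := by
  have hcongr : ∀ {y z : ℝ → E}, Set.EqOn y z (Set.Ici 0) → ∀ {t : ℝ}, 0 ≤ t →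
      ∫ s in (0 : ℝ)..t, A (y s) = ∫ s in (0 : ℝ)..t, A (z s) := fun hyz t ht =>
    intervalIntegral.integral_congr fun s hs =>
      congrArg A (hyz (Set.uIcc_of_le ht ▸ hs : s ∈ Set.Icc 0 t).1)
  refine ⟨fun h t ht => ?_, fun h => ?_⟩
  · rw [hcongr h ht, h ht]
    exact exp_smul_apply_eq_add_integral A x₀ t
  -- Two Picard iterates turn the merely integrable `x` into a differentiable function.
  set y : ℝ → E := fun t => x₀ + ∫ s in (0 : ℝ)..t, A (x s)
  set z : ℝ → E := fun t => x₀ + ∫ s in (0 : ℝ)..t, A (y s)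
  have hAx : ∀ a b, IntervalIntegrable (fun s => A (x s)) volume a b := fun a b =>
    IntegrableOn.intervalIntegrable <|
      A.integrable_comp (hint.integrableOn_isCompact isCompact_uIcc)
  have hy : Continuous y :=
    continuous_const.add (intervalIntegral.continuous_primitive hAx 0)
  have hxy : Set.EqOn x y (Set.Ici 0) := h
  have hyz : Set.EqOn y z (Set.Ici 0) := fun t ht => congrArg (x₀ + ·) (hcongr hxy ht)
  have hz : ∀ t, HasDerivAt z (A (y t)) t := fun t =>
    ((A.continuous.comp hy).integral_hasStrictDerivAt 0 t).hasDerivAt.const_add x₀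
  have hflow := eqOn_exp_smul_apply_of_hasDerivAt fun t ht => hyz ht ▸ hz t
  have hz₀ : z 0 = x₀ := by simp [z]
  rw [hz₀] at hflow
  exact (hxy.trans hyz).trans hflow

end LinearODE

theorem locallyIntegrable_prodMk {X E F : Type*} [TopologicalSpace X] [LocallyCompactSpace X]
    [MeasurableSpace X] {μ : Measure X} [NormedAddCommGroup E] [NormedAddCommGroup F]
    {f : X → E} {g : X → F} (hf : LocallyIntegrable f μ) (hg : LocallyIntegrable g μ) :
    LocallyIntegrable (fun x => (f x, g x)) μ :=
  locallyIntegrable_iff.mpr fun _ hk =>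
    (hf.integrableOn_isCompact hk).prodMk (hg.integrableOn_isCompact hk)

section SwingFlow

variable {V : Type*} [Fintype V]

/-- The vector field of the first-order form of `m φ'' = -d φ' - K φ`. -/
def swingOperator (K : Matrix V V ℝ) (m d : ℝ) : (V → ℝ) × (V → ℝ) →L[ℝ] (V → ℝ) × (V → ℝ) :=
  LinearMap.toContinuousLinearMap
    ((LinearMap.snd ℝ (V → ℝ) (V → ℝ)).prod
      (m⁻¹ • (-(d • LinearMap.snd ℝ (V → ℝ) (V → ℝ)) -
        K.mulVecLin ∘ₗ LinearMap.fst ℝ (V → ℝ) (V → ℝ))))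

/-- The angles and frequencies of `m φ'' = -d φ' - K φ` at time `t` when the system starts at rest
and receives the impulse `J` at time `0`. -/
def swingFlow (K : Matrix V V ℝ) (m d : ℝ) (J : V → ℝ) (t : ℝ) : (V → ℝ) × (V → ℝ) :=
  NormedSpace.exp (t • swingOperator K m d) (0, m⁻¹ • J)

theorem swingFlow_zero (K : Matrix V V ℝ) (m d : ℝ) (J : V → ℝ) :
    swingFlow K m d J 0 = (0, m⁻¹ • J) := by
  simp [swingFlow]

theorem hasDerivAt_swingFlow (K : Matrix V V ℝ) (m d : ℝ) (J : V → ℝ) (t : ℝ) :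
    HasDerivAt (swingFlow K m d J) (swingOperator K m d (swingFlow K m d J t)) t :=
  hasDerivAt_exp_smul_apply _ _ t

theorem integral_swingFlow_dotProduct_self [DecidableEq V] {K : Matrix V V ℝ} {m d : ℝ}
    (hK : K.PosDef) (hm : 0 < m) (hd : 0 < d) (J : V → ℝ) :
    IntegrableOn (fun t => (swingFlow K m d J t).1 ⬝ᵥ (swingFlow K m d J t).1) (Set.Ioi 0) ∧
      ∫ t in Set.Ioi (0 : ℝ), (swingFlow K m d J t).1 ⬝ᵥ (swingFlow K m d J t).1 =
        J ⬝ᵥ K⁻¹ *ᵥ J / (2 * d) := by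
  have hstorage : angleStorage K m d (swingFlow K m d J 0).1 (swingFlow K m d J 0).2 =
      J ⬝ᵥ K⁻¹ *ᵥ J / (2 * d) := by
    rw [swingFlow_zero]
    exact angleStorage_zero_inv_smul K hm.ne' d J
  rw [← hstorage]
  have hflow := hasDerivAt_swingFlow K m d J
  exact integral_dotProduct_self_eq_angleStorage (φ := fun t => (swingFlow K m d J t).1)
    (ω := fun t => (swingFlow K m d J t).2) hK hm hd (fun t => (hflow t).fst)
    fun t => (hflow t).snd

theorem eq_add_integral_swingOperator_iff {K : Matrix V V ℝ} {m : ℝ} (hm : m ≠ 0) (d : ℝ)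
    {J : V → ℝ} {φ ω : ℝ → V → ℝ} {t : ℝ}
    (hint : IntervalIntegrable (fun s => (φ s, ω s)) volume 0 t) :
    (φ t, ω t) = (0, m⁻¹ • J) + ∫ s in (0 : ℝ)..t, swingOperator K m d (φ s, ω s) ↔
      φ t = ∫ s in (0 : ℝ)..t, ω s ∧
        m • ω t = (∫ s in (0 : ℝ)..t, (-(d • ω s) - K *ᵥ φ s)) + J := by
  set F : ℝ → (V → ℝ) × (V → ℝ) := fun s => swingOperator K m d (φ s, ω s)
  have hF : IntervalIntegrable F volume 0 t :=
    ⟨ContinuousLinearMap.integrable_comp _ hint.1, ContinuousLinearMap.integrable_comp _ hint.2⟩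
  have hfst : ∫ s in (0 : ℝ)..t, ω s = (∫ s in (0 : ℝ)..t, F s).1 :=
    (ContinuousLinearMap.fst ℝ (V → ℝ) (V → ℝ)).intervalIntegral_comp_comm hF
  have hsnd : m⁻¹ • ∫ s in (0 : ℝ)..t, (-(d • ω s) - K *ᵥ φ s) = (∫ s in (0 : ℝ)..t, F s).2 := by
    rw [← intervalIntegral.integral_smul]
    exact (ContinuousLinearMap.snd ℝ (V → ℝ) (V → ℝ)).intervalIntegral_comp_comm hF
  rw [Prod.ext_iff, Prod.fst_add, Prod.snd_add, ← hfst, ← hsnd, zero_add, ← smul_add,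
    eq_inv_smul_iff₀ hm, add_comm J]

theorem eqOn_swingFlow_iff {K : Matrix V V ℝ} {m : ℝ} (hm : m ≠ 0) (d : ℝ) {J : V → ℝ}
    {φ ω : ℝ → V → ℝ} (hint : LocallyIntegrable fun s => (φ s, ω s)) :
    Set.EqOn (fun t => (φ t, ω t)) (swingFlow K m d J) (Set.Ici 0) ↔
      (∀ t, 0 ≤ t → φ t = ∫ s in (0 : ℝ)..t, ω s) ∧
        ∀ t, 0 ≤ t → m • ω t = (∫ s in (0 : ℝ)..t, (-(d • ω s) - K *ᵥ φ s)) + J := by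
  refine (eqOn_exp_smul_apply_iff_integral_eq hint).trans ?_
  rw [← forall₂_and]
  exact forall₂_congr fun t _ => eq_add_integral_swingOperator_iff hm d
    (hint.integrableOn_isCompact isCompact_uIcc).intervalIntegrable

end SwingFlow

section Response

variable {G C : Type*} [Fintype G] [Fintype C] [DecidableEq G] [DecidableEq C]

/-- The momentum transferred to the machines by the Dirac fault of the line between `i` and `j`. -/
def faultImpulse (N : PowerNetwork (G ⊕ C)) (P θ : G ⊕ C → ℝ) (τ : ℝ) (i j : G ⊕ C) : G → ℝ :=
  τ • ((kronInjection (N.faultedLaplacian i j) P - kronInjection N.laplacian P)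
    - (kronMatrix (N.faultedLaplacian i j) - kronMatrix N.laplacian) *ᵥ (θ ∘ Sum.inl))

variable {N : PowerNetwork (G ⊕ C)} {P θ : G ⊕ C → ℝ} {m d τ ε : ℝ} {i j : G ⊕ C}
  {φ ω : ℝ → G → ℝ}

theorem setIntegral_dirac_faultTerm (hφ : φ 0 = 0) {t : ℝ} (ht : 0 ≤ t) :
    ∫ s in Set.Icc (0 : ℝ) t,
        τ • ((kronInjection (N.faultedLaplacian i j) P - kronInjection N.laplacian P)
          - (kronMatrix (N.faultedLaplacian i j) - kronMatrix N.laplacian) *ᵥ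
              ((fun k => θ (Sum.inl k)) + φ s)) ∂(Measure.dirac (0 : ℝ)) =
      faultImpulse N P θ τ i j := by
  classical
  rw [setIntegral_dirac, if_pos ⟨le_rfl, ht⟩, hφ, add_zero]
  rfl

theorem isFaultResponse_iff_forall_integral_eq :
    IsFaultResponse N P θ (fun _ => m) (fun _ => d) τ i j ε φ ω ↔
      (∀ t < 0, (φ t, ω t) = 0) ∧ LocallyIntegrable (fun t => (φ t, ω t)) ∧
      (∀ t, 0 ≤ t → φ t = ∫ s in (0 : ℝ)..t, ω s) ∧
      ∀ t, 0 ≤ t → m • ω t = (∫ s in (0 : ℝ)..t,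
        (-(d • ω s) - (kronMatrix N.laplacian + ε • (1 : Matrix G G ℝ)) *ᵥ φ s)) +
          faultImpulse N P θ τ i j := by
  have hφ₀ : (∀ t, 0 ≤ t → φ t = ∫ s in (0 : ℝ)..t, ω s) → φ 0 = 0 := fun hangle => by
    rw [hangle 0 le_rfl, intervalIntegral.integral_same]
  constructor
  · intro h
    have hω : ∀ a b, IntervalIntegrable ω volume a b := fun a b =>
      (h.locallyIntegrable.integrableOn_isCompact isCompact_uIcc).intervalIntegrable
    have hφ : φ = (Set.Ici 0).indicator fun t => ∫ s in (0 : ℝ)..t, ω s := by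
      ext1 t
      by_cases ht : 0 ≤ t
      · rw [Set.indicator_of_mem (Set.mem_Ici.mpr ht), h.angle_eq t ht]
      · rw [not_le] at ht
        rw [Set.indicator_of_notMem (Set.notMem_Ici.mpr ht), h.angle_before t ht]
    have hφint : LocallyIntegrable φ := hφ ▸
      (intervalIntegral.continuous_primitive hω 0).locallyIntegrable.indicator measurableSet_Ici
    refine ⟨fun t ht => Prod.ext (h.angle_before t ht) (h.freq_before t ht),
      locallyIntegrable_prodMk hφint h.locallyIntegrable, h.angle_eq, fun t ht => ?_⟩
    simpa only [diagonal_const_mulVec, setIntegral_dirac_faultTerm (hφ₀ h.angle_eq) ht]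
      using h.freq_eq t ht
  · rintro ⟨hbefore, hint, hangle, hω⟩
    refine ⟨fun t ht => congrArg Prod.fst (hbefore t ht),
      fun t ht => congrArg Prod.snd (hbefore t ht), ?_, hangle, fun t ht => ?_⟩
    · exact locallyIntegrable_iff.mpr fun k hk => (hint.integrableOn_isCompact hk).snd
    · simpa only [diagonal_const_mulVec, setIntegral_dirac_faultTerm (hφ₀ hangle) ht] using hω t ht

theorem isFaultResponse_iff_eq_indicator_swingFlow (hm : m ≠ 0) :
    IsFaultResponse N P θ (fun _ => m) (fun _ => d) τ i j ε φ ω ↔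
      (fun t => (φ t, ω t)) = (Set.Ici 0).indicator
        (swingFlow (kronMatrix N.laplacian + ε • (1 : Matrix G G ℝ)) m d
          (faultImpulse N P θ τ i j)) := by
  set x := swingFlow (kronMatrix N.laplacian + ε • (1 : Matrix G G ℝ)) m d
    (faultImpulse N P θ τ i j)
  rw [isFaultResponse_iff_forall_integral_eq]
  constructor
  · rintro ⟨hbefore, hint, hafter⟩
    ext1 t
    by_cases ht : 0 ≤ t
    · rw [Set.indicator_of_mem (Set.mem_Ici.mpr ht)]
      exact (eqOn_swingFlow_iff hm d hint).mpr hafter ht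
    · rw [not_le] at ht
      rw [Set.indicator_of_notMem (Set.notMem_Ici.mpr ht), hbefore t ht]
  · intro h
    have hx : LocallyIntegrable ((Set.Ici 0).indicator x) :=
      (continuous_exp_smul_apply _ _).locallyIntegrable.indicator measurableSet_Ici
    rw [← h] at hx
    refine ⟨fun t ht => ?_, hx, (eqOn_swingFlow_iff hm d hx).mp fun t ht => ?_⟩
    · exact (congrFun h t).trans (Set.indicator_of_notMem (not_le.mpr ht) _)
    · exact (congrFun h t).trans (Set.indicator_of_mem ht _)

theorem existsUnique_isFaultResponse (hm : m ≠ 0) :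
    ∃! x : (ℝ → G → ℝ) × (ℝ → G → ℝ),
      IsFaultResponse N P θ (fun _ => m) (fun _ => d) τ i j ε x.1 x.2 := by
  simp only [isFaultResponse_iff_eq_indicator_swingFlow hm]
  set x := (Set.Ici 0).indicator (swingFlow (kronMatrix N.laplacian + ε • (1 : Matrix G G ℝ)) m d
    (faultImpulse N P θ τ i j))
  exact ⟨(fun t => (x t).1, fun t => (x t).2), rfl, fun y hy => Prod.ext
    (funext fun t => congrArg Prod.fst (congrFun hy t))
    (funext fun t => congrArg Prod.snd (congrFun hy t))⟩

theorem IsFaultResponse.integral_dotProduct_self (hm : 0 < m) (hd : 0 < d)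
    (hK : (kronMatrix N.laplacian + ε • (1 : Matrix G G ℝ)).PosDef)
    (h : IsFaultResponse N P θ (fun _ => m) (fun _ => d) τ i j ε φ ω) :
    IntegrableOn (fun t => φ t ⬝ᵥ φ t) (Set.Ioi 0) ∧
      angleCoherence φ = faultImpulse N P θ τ i j ⬝ᵥ
        (kronMatrix N.laplacian + ε • (1 : Matrix G G ℝ))⁻¹ *ᵥ faultImpulse N P θ τ i j /
          (2 * d) := by
  have hmain := integral_swingFlow_dotProduct_self hK hm hd (faultImpulse N P θ τ i j)
  have heq := (isFaultResponse_iff_eq_indicator_swingFlow hm.ne').mp h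
  have hφ : ∀ t ∈ Set.Ioi (0 : ℝ), (swingFlow _ m d (faultImpulse N P θ τ i j) t).1 = φ t :=
    fun t ht => congrArg Prod.fst
      ((congrFun heq t).trans (Set.indicator_of_mem (le_of_lt ht) _)).symm
  have hcongr : Set.EqOn (fun t => (swingFlow _ m d _ t).1 ⬝ᵥ (swingFlow _ m d _ t).1)
      (fun t => φ t ⬝ᵥ φ t) (Set.Ioi 0) := fun t ht => congrArg (fun v => v ⬝ᵥ v) (hφ t ht)
  exact ⟨hmain.1.congr_fun hcongr measurableSet_Ioi,
    (setIntegral_congr_fun measurableSet_Ioi hcongr).symm.trans hmain.2⟩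

theorem faultImpulse_eq_smul_kronInjection (h : KronReducible N i j) (θ : G ⊕ C → ℝ) (τ : ℝ) :
    faultImpulse N (N.laplacian *ᵥ θ) θ τ i j =
      (τ * N.lineFlow θ i j / (1 - N.b i j * passiveForm N.laplacian (edgeVec i j))) •
        kronInjection N.laplacian (edgeVec i j) := by
  rw [faultImpulse, kronInjection_sub_sub_kronMatrix_mulVec h.1 h.2,
    PowerNetwork.laplacian_sub_faultedLaplacian_mulVec, kronInjection_smul,
    PowerNetwork.faultedLaplacian, kronInjection_sub_vecMulVec h.1 h.2, smul_smul, smul_smul,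
    div_eq_mul_inv, mul_assoc]

theorem hasAngleCoherence_of_faultImpulse_eq [Nonempty G] (hL : (kronMatrix N.laplacian).PosSemidef)
    (hm : 0 < m) (hd : 0 < d) {y : G → ℝ}
    (hy : faultImpulse N P θ τ i j = kronMatrix N.laplacian *ᵥ y) :
    HasAngleCoherence N P θ (fun _ => m) (fun _ => d) τ i j
      (y ⬝ᵥ kronMatrix N.laplacian *ᵥ y / (2 * d)) := by
  refine ⟨fun ε _ => existsUnique_isFaultResponse hm.ne', fun φ ω hφ => ?_⟩
  have hint := fun (ε : ℝ) (hε : 0 < ε) =>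
    (hφ ε hε).integral_dotProduct_self hm hd (add_smul_one_posDef hL hε)
  refine ⟨fun ε hε => (hint ε hε).1, ?_⟩
  refine ((tendsto_dotProduct_inv_add_smul_one hL y).div_const (2 * d)).congr' ?_
  filter_upwards [self_mem_nhdsWithin] with ε hε
  rw [(hint ε hε).2, hy]

theorem dotProduct_kronMatrix_mulVec_symPinv_edgeVec [Nonempty G] (hN : N.graph.Connected)
    (i j : G ⊕ C) :
    ((symPinv N.laplacian_isHermitian *ᵥ edgeVec i j) ∘ Sum.inl) ⬝ᵥ kronMatrix N.laplacian *ᵥ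
        ((symPinv N.laplacian_isHermitian *ᵥ edgeVec i j) ∘ Sum.inl) =
      N.resistanceDistance i j - passiveForm N.laplacian (edgeVec i j) := by
  have hsplit := dotProduct_mulVec_eq_kronMatrix_add_passiveForm N.laplacian_isHermitian
    (PowerNetwork.isUnit_det_laplacian_toBlocks₂₂ hN)
    (symPinv N.laplacian_isHermitian *ᵥ edgeVec i j)
  rw [N.laplacian_mulVec_symPinv_edgeVec hN, dotProduct_comm] at hsplit
  exact eq_sub_of_add_eq hsplit.symm

theorem hasAngleCoherence_of_isNonsplittingLine [Nonempty G] (hm : 0 < m) (hd : 0 < d) (τ : ℝ)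
    (θ : G ⊕ C → ℝ) (h : N.IsNonsplittingLine i j) :
    HasAngleCoherence N (N.laplacian *ᵥ θ) θ (fun _ => m) (fun _ => d) τ i j
      (N.lineFlow θ i j ^ 2 * τ ^ 2 / (2 * d) *
        ((N.resistanceDistance i j - passiveForm N.laplacian (edgeVec i j)) /
          (1 - N.b i j * passiveForm N.laplacian (edgeVec i j)) ^ 2)) := by
  have hN := h.connected
  set c := τ * N.lineFlow θ i j / (1 - N.b i j * passiveForm N.laplacian (edgeVec i j)) with hc
  set y := (symPinv N.laplacian_isHermitian *ᵥ edgeVec i j) ∘ Sum.inl with hy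
  have himpulse :
      faultImpulse N (N.laplacian *ᵥ θ) θ τ i j = kronMatrix N.laplacian *ᵥ (c • y) := by
    rw [faultImpulse_eq_smul_kronInjection h.kronReducible, mulVec_smul, hy,
      ← kronInjection_mulVec h.kronReducible.1, N.laplacian_mulVec_symPinv_edgeVec hN]
  have hL := kronMatrix_posSemidef N.laplacian_posSemidef
    (PowerNetwork.laplacian_toBlocks₂₂_posDef hN)
  have hcoherence := hasAngleCoherence_of_faultImpulse_eq hL hm hd himpulse
  rw [mulVec_smul, smul_dotProduct, dotProduct_smul, hy,
    dotProduct_kronMatrix_mulVec_symPinv_edgeVec hN] at hcoherence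
  convert hcoherence using 1
  rw [hc, smul_eq_mul, smul_eq_mul]
  field_simp
end Response

end KronSwing
end

theorem proposition7 {G C : Type*} [Fintype G] [Fintype C] [DecidableEq G] [DecidableEq C]
    [Nonempty G] (N : KronSwing.PowerNetwork (G ⊕ C)) (P θ : G ⊕ C → ℝ)
    (hP : P = N.laplacian *ᵥ θ) (d γ τ : ℝ) (hd : 0 < d) (hγ : 0 < γ) :
    -- both ends are synchronous machines
    (∀ α β : G, N.IsNonsplittingLine (Sum.inl α) (Sum.inl β) →
      KronSwing.KronReducible N (Sum.inl α) (Sum.inl β) ∧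
      KronSwing.HasAngleCoherence N P θ (fun _ => d / γ) (fun _ => d) τ (Sum.inl α) (Sum.inl β)
        (N.lineFlow θ (Sum.inl α) (Sum.inl β) ^ 2 * τ ^ 2 / (2 * d) *
          N.resistanceDistance (Sum.inl α) (Sum.inl β))) ∧
    -- both ends are passive
    (∀ α β : C, N.IsNonsplittingLine (Sum.inr α) (Sum.inr β) →
      KronSwing.KronReducible N (Sum.inr α) (Sum.inr β) ∧
      1 - N.b (Sum.inr α) (Sum.inr β) *
        (KronSwing.edgeVec α β ⬝ᵥ
          (N.laplacian.toBlocks₂₂⁻¹ *ᵥ KronSwing.edgeVec α β)) ≠ 0 ∧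
      KronSwing.HasAngleCoherence N P θ (fun _ => d / γ) (fun _ => d) τ (Sum.inr α) (Sum.inr β)
        (N.lineFlow θ (Sum.inr α) (Sum.inr β) ^ 2 * τ ^ 2 / (2 * d) *
          ((N.resistanceDistance (Sum.inr α) (Sum.inr β) -
              KronSwing.edgeVec α β ⬝ᵥ
                (N.laplacian.toBlocks₂₂⁻¹ *ᵥ KronSwing.edgeVec α β)) /
            (1 - N.b (Sum.inr α) (Sum.inr β) *
              (KronSwing.edgeVec α β ⬝ᵥ
                (N.laplacian.toBlocks₂₂⁻¹ *ᵥ KronSwing.edgeVec α β))) ^ 2))) ∧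
    -- the end `α` is a synchronous machine and the end `β` is passive
    (∀ (α : G) (β : C), N.IsNonsplittingLine (Sum.inl α) (Sum.inr β) →
      KronSwing.KronReducible N (Sum.inl α) (Sum.inr β) ∧
      1 - N.b (Sum.inl α) (Sum.inr β) * N.laplacian.toBlocks₂₂⁻¹ β β ≠ 0 ∧
      KronSwing.HasAngleCoherence N P θ (fun _ => d / γ) (fun _ => d) τ (Sum.inl α) (Sum.inr β)
        (N.lineFlow θ (Sum.inl α) (Sum.inr β) ^ 2 * τ ^ 2 / (2 * d) *
          ((N.resistanceDistance (Sum.inl α) (Sum.inr β) -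
              N.laplacian.toBlocks₂₂⁻¹ β β) /
            (1 - N.b (Sum.inl α) (Sum.inr β) * N.laplacian.toBlocks₂₂⁻¹ β β) ^ 2))) := by
  subst hP
  have hm : 0 < d / γ := div_pos hd hγ
  refine ⟨fun α β h => ⟨h.kronReducible, ?_⟩, fun α β h => ⟨h.kronReducible, ?_⟩,
    fun α β h => ⟨h.kronReducible, ?_⟩⟩
  · simpa [KronSwing.passiveForm_edgeVec_inl_inl] using
      KronSwing.hasAngleCoherence_of_isNonsplittingLine hm hd τ θ h
  · rw [← KronSwing.passiveForm_edgeVec_inr_inr]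
    exact ⟨KronSwing.one_sub_mul_passiveForm_ne_zero h.kronReducible.1 h.kronReducible.2,
      KronSwing.hasAngleCoherence_of_isNonsplittingLine hm hd τ θ h⟩
  · rw [← KronSwing.passiveForm_edgeVec_inl_inr _ α]
    exact ⟨KronSwing.one_sub_mul_passiveForm_ne_zero h.kronReducible.1 h.kronReducible.2,
      KronSwing.hasAngleCoherence_of_isNonsplittingLine hm hd τ θ h⟩
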